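/- Let $n,d\ge 0$ be integers, let $\Omega\subset\mathbb R^n$ be compact, let $\mathbb P_d$ be the space of real polynomials in $n$ variables of total degree at most $d$, $N:=\dim\mathbb P_d$, $\|f\|_\Omega:=\sup_{x\in\Omega}|f(x)|$, and let $\mu$ be Lebesgue measure. Suppose that $\Omega$ satisfies a Markov inequality with constant $c$ and exponent $r$: for all $k\in\mathbb N$, every polynomial $p$ of total degree at most $k$ and every $x\in\Omega$, $$|\nabla p(x)|\le c\,k^r\,\|p\|_\Omega ,$$ with $|\cdot|$ the Euclidean norm. Call a compact set a support if it is the closure of a connected open set $U$ of positive measure and has the same finite measure as $U$. Let $\xi_1,\dots,\xi_N$ be nodes that are unisolvent for $\mathbb P_d$ (if $p\in\mathbb P_d$ and $p(\xi_i)=0$ for all $i$, then $p=0$), let $\ell_{\xi_j}\in\mathbb P_d$ be the polynomials with $\ell_{\xi_j}(\xi_i)=\delta_{ij}$, and let $\Lambda_d^{\mathcal X}:=\sup_{x\in\Omega}\sum_{i=1}^N|\ell_{\xi_i}(x)|$. Let $K_1,\dots,K_N\subset\Omega$ be convex supports with $\xi_i\in K_i$ and $\mu(K_i\cap K_j)=0$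 for $i\ne j$, and put $r_{\max}:=\frac12\max_i\operatorname{diam}(K_i)$. Let $\alpha\in(0,1)$ be such that $$2\,c\,d^r\,\Lambda_d^{\mathcal X}\,r_{\max}<\alpha ,\qquad\text{i.e.}\qquad r_{\max}<\frac{\alpha}{2\,c\,d^r\Lambda_d^{\mathcal X}}\ \text{ if the denominator is nonzero.}$$ Then $K_1,\dots,K_N$ are unisolvent for $\mathbb P_d$ (if $p\in\mathbb P_d$ and $\int_{K_i}p=0$ for all $i$, then $p=0$), so that there are unique $\ell_{K_j}\in\mathbb P_d$ with $\int_{K_i}\ell_{K_j}=\delta_{ij}$, and the histopolation Lebesgue constant satisfies $$\Lambda_d^K:=\sup_{S}\frac1{\mu(S)}\sum_{i=1}^N\mu(K_i)\left|\int_S\ell_{K_i}\right|\le\frac{\Lambda_d^{\mathcal X}}{1-\alpha},$$ where $S$ ranges over the supports contained in $\Omega$; the same bound holds for the pointwise form $\sup_{x\in\Omega}\sum_{i=1}^N\mu(K_i)|\ell_{K_i}(x)|$. -/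

import Mathlib

open MeasureTheory

noncomputable section

namespace Histopolation

/-- `ℝⁿ` with the Euclidean norm and Lebesgue measure. -/
abbrev E (n : ℕ) : Type := EuclideanSpace ℝ (Fin n)

/-- Real polynomials in `n` variables of total degree at most `d`. -/
abbrev PolySpace (n d : ℕ) : Submodule ℝ (MvPolynomial (Fin n) ℝ) :=
  MvPolynomial.restrictTotalDegree (Fin n) ℝ d

/-- `N`, the dimension of the space of polynomials of total degree at most `d`. -/
def polyDim (n d : ℕ) : ℕ := Module.finrank ℝ (PolySpace n d)

/-- The function on `ℝⁿ` defined by a polynomial. -/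
def polyFun {n : ℕ} (p : MvPolynomial (Fin n) ℝ) (x : E n) : ℝ :=
  MvPolynomial.eval (fun i => x i) p

/-- The uniform norm on `Ω`. -/
def supNorm {n : ℕ} (Ω : Set (E n)) (f : E n → ℝ) : ℝ := ⨆ x : Ω, |f x|

/-- `Ω` satisfies the Markov inequality with constant `c` and exponent `r`: every polynomial of
degree at most `k` has `|∇p| ≤ c k ^ r ‖p‖_Ω` on `Ω` (Euclidean norm of the gradient). -/
def IsMarkov {n : ℕ} (Ω : Set (E n)) (c r : ℝ) : Prop :=
  ∀ (k : ℕ) (p : MvPolynomial (Fin n) ℝ), p.totalDegree ≤ k →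
    ∀ x ∈ Ω, ‖gradient (polyFun p) x‖ ≤ c * (k : ℝ) ^ r * supNorm Ω (polyFun p)

/-- The compact sets used as supports: closures of connected open sets of finite positive measure,
the closure adding no measure. -/
def IsSupport {n : ℕ} (K : Set (E n)) : Prop :=
  IsCompact K ∧ ∃ U : Set (E n), IsOpen U ∧ IsConnected U ∧ K = closure U ∧
    0 < volume U ∧ volume U = volume K ∧ volume K < ⊤

/-- Point values at the nodes. -/
def nodalDof {n d N : ℕ} (ξ : Fin N → E n) (i : Fin N) (p : PolySpace n d) : ℝ :=
  polyFun (p : MvPolynomial (Fin n) ℝ) (ξ i)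

/-- Integrals over the supports. -/
def histDof {n d N : ℕ} (K : Fin N → Set (E n)) (i : Fin N) (p : PolySpace n d) : ℝ :=
  ∫ x in K i, polyFun (p : MvPolynomial (Fin n) ℝ) x

/-- Unisolvence of `N = dim` degrees of freedom: only the zero polynomial annihilates all. -/
def Unisolvent {n d : ℕ} (L : Fin (polyDim n d) → PolySpace n d → ℝ) : Prop :=
  ∀ p : PolySpace n d, (∀ i, L i p = 0) → p = 0

/-- The duality relations `L i (ℓ j) = δ_{ij}`. -/
def IsLagrangeBasis {n d : ℕ} (L : Fin (polyDim n d) → PolySpace n d → ℝ)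
    (ℓ : Fin (polyDim n d) → PolySpace n d) : Prop :=
  ∀ i j, L i (ℓ j) = if i = j then 1 else 0

open Classical in
/-- The Lagrange basis of the degrees of freedom `L`; for linear unisolvent `L` it is the unique
family satisfying the duality relations. -/
def lagrangeBasis {n d : ℕ} (L : Fin (polyDim n d) → PolySpace n d → ℝ) :
    Fin (polyDim n d) → PolySpace n d :=
  if h : ∃ ℓ, IsLagrangeBasis L ℓ then h.choose else 0

/-- The nodal Lebesgue constant `sup_{x ∈ Ω} ∑ᵢ |ℓ_{ξᵢ}(x)|`. -/
def nodalLebesgue {n d : ℕ} (Ω : Set (E n)) (ξ : Fin (polyDim n d) → E n) : ℝ :=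
  ⨆ x : Ω, ∑ i, |polyFun (lagrangeBasis (nodalDof (d := d) ξ) i : MvPolynomial (Fin n) ℝ) x|

/-- The histopolation Lebesgue constant
`sup_{S ⊆ Ω} μ(S)⁻¹ ∑ᵢ μ(Kᵢ) |∫_S ℓ_{Kᵢ}|`, over all supports `S ⊆ Ω`. -/
def histLebesgue {n d : ℕ} (Ω : Set (E n)) (K : Fin (polyDim n d) → Set (E n)) : ℝ :=
  ⨆ S : {S : Set (E n) // IsSupport S ∧ S ⊆ Ω},
    (volume.real S.1)⁻¹ * ∑ i, volume.real (K i) *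
      |∫ x in S.1, polyFun (lagrangeBasis (histDof (d := d) K) i : MvPolynomial (Fin n) ℝ) x|

/-- The pointwise form `sup_{x ∈ Ω} ∑ᵢ μ(Kᵢ) |ℓ_{Kᵢ}(x)|` of the same constant. -/
def histLebesguePt {n d : ℕ} (Ω : Set (E n)) (K : Fin (polyDim n d) → Set (E n)) : ℝ :=
  ⨆ x : Ω, ∑ i, volume.real (K i) *
    |polyFun (lagrangeBasis (histDof (d := d) K) i : MvPolynomial (Fin n) ℝ) x|

/-- `r_max`, half of the largest diameter. -/
def rMax {n N : ℕ} (K : Fin N → Set (E n)) : ℝ := (1 / 2) * ⨆ i, Metric.diam (K i)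

end Histopolation

end

open MeasureTheory

namespace Histopolation

/-! Everything follows from one stability estimate: if the averages of `p` over all `K i` are at
most `m` in absolute value, then `|p| ≤ Λ / (1 - α) * m` on `Ω`. By the Markov inequality and
convexity, `p` oscillates on `K i` by at most `c d ^ r ‖p‖ (2 r_max)`, so `|p(ξ i)|` exceeds `m` by
at most that. Nodal interpolation multiplies by `Λ`, and the smallness condition gives `‖p‖ ≤ Λ m +
α ‖p‖`, where the last term is absorbed. Taking `m = 0` gives unisolvence. Taking `m = 1` gives both
Lebesgue bounds by duality (`sum_mul_abs_apply_le`), applied to integration over `S` and to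
evaluation at `x`. -/

theorem differentiable_polyFun {n : ℕ} (p : MvPolynomial (Fin n) ℝ) :
    Differentiable ℝ (polyFun p) := by
  unfold polyFun
  induction p using MvPolynomial.induction_on with
  | C a => simp
  | add p q hp hq => simpa only [map_add] using hp.fun_add hq
  | mul_X p i hp =>
    have hX : Differentiable ℝ fun x : E n => x i := by fun_prop
    simpa only [map_mul, MvPolynomial.eval_X] using hp.fun_mul hX

theorem continuous_polyFun {n : ℕ} (p : MvPolynomial (Fin n) ℝ) : Continuous (polyFun p) :=
  (differentiable_polyFun p).continuous

theorem norm_gradient_eq_norm_fderiv {n : ℕ} (f : E n → ℝ) (x : E n) :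
    ‖gradient f x‖ = ‖fderiv ℝ f x‖ := by
  simp [gradient]

/-- Evaluation at a point as a linear form on polynomials. -/
noncomputable def evalForm (n d : ℕ) (x : E n) : PolySpace n d →ₗ[ℝ] ℝ where
  toFun p := polyFun (p : MvPolynomial (Fin n) ℝ) x
  map_add' p q := by simp [polyFun]
  map_smul' a p := by simp [polyFun]

/-- Integration over a compact set as a linear form on polynomials. -/
noncomputable def integralForm (n d : ℕ) (S : Set (E n)) (hS : IsCompact S) : PolySpace n d →ₗ[ℝ] ℝ where
  toFun p := ∫ x in S, polyFun (p : MvPolynomial (Fin n) ℝ) x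
  map_add' p q := by
    rw [← integral_add ((continuous_polyFun _).continuousOn.integrableOn_compact hS)
      ((continuous_polyFun _).continuousOn.integrableOn_compact hS)]
    simp [polyFun]
  map_smul' a p := by
    simp [polyFun, integral_const_mul]

/-- Linear unisolvent degrees of freedom have a Lagrange basis. -/
theorem exists_isLagrangeBasis {n d : ℕ} (L : Fin (polyDim n d) → PolySpace n d →ₗ[ℝ] ℝ)
    (hL : Unisolvent fun i p => L i p) : ∃ ℓ, IsLagrangeBasis (fun i p => L i p) ℓ := by
  have hinj : Function.Injective (LinearMap.pi L) := by
    rw [← LinearMap.ker_eq_bot, LinearMap.ker_eq_bot']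
    exact fun p hp => hL p fun i => congrFun hp i
  have hsurj : Function.Surjective (LinearMap.pi L) :=
    (LinearMap.injective_iff_surjective_of_finrank_eq_finrank (Module.finrank_fin_fun ℝ).symm).1 hinj
  choose ℓ hℓ using fun j : Fin (polyDim n d) => hsurj (Pi.single j 1)
  refine ⟨ℓ, fun i j => ?_⟩
  simpa [Pi.single_apply] using congrFun (hℓ j) i

theorem isLagrangeBasis_lagrangeBasis {n d : ℕ} (L : Fin (polyDim n d) → PolySpace n d →ₗ[ℝ] ℝ)
    (hL : Unisolvent fun i p => L i p) :
    IsLagrangeBasis (fun i p => L i p) (lagrangeBasis fun i p => L i p) := by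
  have h := exists_isLagrangeBasis L hL
  rw [lagrangeBasis, dif_pos h]
  exact h.choose_spec

theorem IsLagrangeBasis.apply_sum {n d : ℕ} {L : Fin (polyDim n d) → PolySpace n d →ₗ[ℝ] ℝ}
    {ℓ : Fin (polyDim n d) → PolySpace n d} (hℓ : IsLagrangeBasis (fun i p => L i p) ℓ)
    (a : Fin (polyDim n d) → ℝ) (i : Fin (polyDim n d)) : L i (∑ j, a j • ℓ j) = a i := by
  have h : ∀ j, L i (ℓ j) = if i = j then 1 else 0 := hℓ i
  simp [h]

theorem IsLagrangeBasis.sum_smul_eq {n d : ℕ} {L : Fin (polyDim n d) → PolySpace n d →ₗ[ℝ] ℝ}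
    {ℓ : Fin (polyDim n d) → PolySpace n d} (hL : Unisolvent fun i p => L i p)
    (hℓ : IsLagrangeBasis (fun i p => L i p) ℓ) (p : PolySpace n d) :
    ∑ j, L j p • ℓ j = p := by
  refine sub_eq_zero.1 (hL _ fun i => ?_)
  change L i _ = 0
  rw [map_sub, hℓ.apply_sum, sub_self]

/-- Compactness bounds the range; an unbounded real supremum would default to `0`. -/
theorem abs_polyFun_le_supNorm {n : ℕ} {Ω : Set (E n)} (hΩ : IsCompact Ω)
    (p : MvPolynomial (Fin n) ℝ) {x : E n} (hx : x ∈ Ω) :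
    |polyFun p x| ≤ supNorm Ω (polyFun p) := by
  have hb : BddAbove (Set.range fun x : Ω => |polyFun p x|) := by
    have := hΩ.bddAbove_image (continuous_polyFun p).abs.continuousOn
    rwa [Set.image_eq_range] at this
  exact le_ciSup hb ⟨x, hx⟩

theorem supNorm_nonneg {n : ℕ} (Ω : Set (E n)) (f : E n → ℝ) : 0 ≤ supNorm Ω f :=
  Real.iSup_nonneg fun _ => abs_nonneg _

theorem nodalLebesgue_nonneg {n d : ℕ} (Ω : Set (E n)) (ξ : Fin (polyDim n d) → E n) :
    0 ≤ nodalLebesgue (d := d) Ω ξ :=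
  Real.iSup_nonneg fun _ => Finset.sum_nonneg fun _ _ => abs_nonneg _

theorem sum_abs_nodalBasis_le {n d : ℕ} {Ω : Set (E n)} (hΩ : IsCompact Ω)
    (ξ : Fin (polyDim n d) → E n) {x : E n} (hx : x ∈ Ω) :
    ∑ i, |polyFun (lagrangeBasis (nodalDof (d := d) ξ) i : MvPolynomial (Fin n) ℝ) x| ≤
      nodalLebesgue (d := d) Ω ξ := by
  let g : E n → ℝ := fun x =>
    ∑ i, |polyFun (lagrangeBasis (nodalDof (d := d) ξ) i : MvPolynomial (Fin n) ℝ) x|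
  have hg : Continuous g := continuous_finsetSum _ fun i _ => (continuous_polyFun _).abs
  have hb : BddAbove (Set.range fun x : Ω => g x) := by
    have := hΩ.bddAbove_image hg.continuousOn
    rwa [Set.image_eq_range] at this
  exact le_ciSup hb ⟨x, hx⟩

/-- The interpolation bound `|p| ≤ Λ max |p(ξᵢ)|` on `Ω`. -/
theorem abs_polyFun_le_nodalLebesgue_mul {n d : ℕ} {Ω : Set (E n)} (hΩ : IsCompact Ω)
    {ξ : Fin (polyDim n d) → E n} (hξ : Unisolvent (nodalDof (d := d) ξ)) (p : PolySpace n d)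
    {m : ℝ} (hm : 0 ≤ m) (hp : ∀ i, |polyFun (p : MvPolynomial (Fin n) ℝ) (ξ i)| ≤ m)
    {x : E n} (hx : x ∈ Ω) :
    |polyFun (p : MvPolynomial (Fin n) ℝ) x| ≤ nodalLebesgue (d := d) Ω ξ * m := by
  have hℓ := isLagrangeBasis_lagrangeBasis (fun i => evalForm n d (ξ i)) hξ
  have hsum := congrArg (evalForm n d x) (hℓ.sum_smul_eq hξ p)
  rw [map_sum] at hsum
  change |evalForm n d x p| ≤ _
  rw [← hsum]
  refine (Finset.abs_sum_le_sum_abs _ _).trans ?_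
  refine le_trans ?_ (mul_le_mul_of_nonneg_right (sum_abs_nodalBasis_le hΩ ξ hx) hm)
  rw [Finset.sum_mul]
  refine Finset.sum_le_sum fun i _ => ?_
  rw [map_smul, smul_eq_mul, abs_mul, mul_comm]
  exact mul_le_mul_of_nonneg_left (hp i) (abs_nonneg _)

/-- The sign of `c` is not assumed; testing the inequality on the constant `1`, of sup norm `1`,
supplies it. -/
theorem IsMarkov.coeff_nonneg {n : ℕ} {Ω : Set (E n)} {c r : ℝ} (hM : IsMarkov Ω c r)
    (hne : Ω.Nonempty) (k : ℕ) : 0 ≤ c * (k : ℝ) ^ r := by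
  obtain ⟨x, hx⟩ := hne
  have : Nonempty Ω := ⟨⟨x, hx⟩⟩
  have h := (norm_nonneg _).trans (hM k 1 (by simp) x hx)
  simpa [supNorm, polyFun] using h

/-- A Markov inequality makes polynomials Lipschitz on convex subsets. -/
theorem IsMarkov.abs_sub_le {n k : ℕ} {Ω C : Set (E n)} {c r : ℝ} (hM : IsMarkov Ω c r)
    (hC : Convex ℝ C) (hCΩ : C ⊆ Ω) {p : MvPolynomial (Fin n) ℝ} (hp : p.totalDegree ≤ k)
    {x y : E n} (hx : x ∈ C) (hy : y ∈ C) :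
    |polyFun p y - polyFun p x| ≤ c * (k : ℝ) ^ r * supNorm Ω (polyFun p) * dist y x := by
  rw [dist_eq_norm]
  refine hC.norm_image_sub_le_of_norm_fderiv_le (𝕜 := ℝ)
    (fun z _ => differentiable_polyFun p z) (fun z hz => ?_) hx hy
  rw [← norm_gradient_eq_norm_fderiv]
  exact hM k p hp z (hCΩ hz)

theorem diam_le_two_mul_rMax {n N : ℕ} (K : Fin N → Set (E n)) (i : Fin N) :
    Metric.diam (K i) ≤ 2 * rMax K := by
  have h := le_ciSup (Set.finite_range fun i => Metric.diam (K i)).bddAbove i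
  simp only [rMax]
  linarith

theorem IsSupport.volume_real_pos {n : ℕ} {K : Set (E n)} (hK : IsSupport K) :
    0 < volume.real K := by
  obtain ⟨_, U, _, _, _, hpos, heq, hfin⟩ := hK
  exact ENNReal.toReal_pos (heq ▸ hpos).ne' hfin.ne

/-- A point value differs from the average over a compact set by at most the oscillation. -/
theorem abs_le_of_abs_setIntegral_le {n : ℕ} {K : Set (E n)} (hK : IsCompact K)
    (hpos : 0 < volume.real K) {f : E n → ℝ} (hf : Continuous f) {x₀ : E n} {m δ : ℝ}
    (hm : |∫ x in K, f x| ≤ m * volume.real K) (hδ : ∀ x ∈ K, |f x - f x₀| ≤ δ) :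
    |f x₀| ≤ m + δ := by
  have hfin : volume K < ⊤ := hK.measure_lt_top
  have h := norm_setIntegral_le_of_norm_le_const (f := fun x => f x - f x₀) hfin hδ
  rw [integral_sub (hf.continuousOn.integrableOn_compact hK) (integrableOn_const hfin.ne),
    setIntegral_const, smul_eq_mul, Real.norm_eq_abs] at h
  have h1 : |volume.real K * f x₀| ≤ (m + δ) * volume.real K := by
    rw [abs_le] at *
    constructor <;> linarith [h.1, h.2, hm.1, hm.2]
  rw [abs_mul, abs_of_pos hpos, mul_comm] at h1
  exact le_of_mul_le_mul_right h1 hpos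

/-- Under the smallness condition, polynomials are controlled on `Ω` by their averages over the
supports. -/
theorem abs_polyFun_le_of_abs_average_le {n d : ℕ} {Ω : Set (E n)} (hΩ : IsCompact Ω)
    {c r : ℝ} (hMarkov : IsMarkov Ω c r)
    {ξ : Fin (polyDim n d) → E n} (hξ : Unisolvent (nodalDof (d := d) ξ))
    {K : Fin (polyDim n d) → Set (E n)}
    (hKsupp : ∀ i, IsSupport (K i)) (hKconv : ∀ i, Convex ℝ (K i)) (hKΩ : ∀ i, K i ⊆ Ω)
    (hξK : ∀ i, ξ i ∈ K i) {α : ℝ} (hα : α < 1)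
    (hr : 2 * c * (d : ℝ) ^ r * nodalLebesgue (d := d) Ω ξ * rMax K < α)
    (p : PolySpace n d) {m : ℝ} (hm : 0 ≤ m)
    (hp : ∀ i, |histDof K i p| ≤ m * volume.real (K i)) {x : E n} (hx : x ∈ Ω) :
    |polyFun (p : MvPolynomial (Fin n) ℝ) x| ≤ nodalLebesgue (d := d) Ω ξ / (1 - α) * m := by
  have : Nonempty Ω := ⟨⟨x, hx⟩⟩
  set Λ := nodalLebesgue (d := d) Ω ξ
  set s := supNorm Ω (polyFun (p : MvPolynomial (Fin n) ℝ)) with hs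
  have hs0 : 0 ≤ s := supNorm_nonneg _ _
  have hM := hMarkov.coeff_nonneg ⟨x, hx⟩ d
  have hρ : 0 ≤ rMax K :=
    mul_nonneg (by norm_num) (Real.iSup_nonneg fun _ => Metric.diam_nonneg)
  have hdeg := (MvPolynomial.mem_restrictTotalDegree _ _ _).1 p.2
  have hnode : ∀ i, |polyFun (p : MvPolynomial (Fin n) ℝ) (ξ i)| ≤
      m + c * (d : ℝ) ^ r * s * (2 * rMax K) := fun i =>
    abs_le_of_abs_setIntegral_le (hKsupp i).1 (hKsupp i).volume_real_pos (continuous_polyFun _)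
      (hp i) fun y hy => (hMarkov.abs_sub_le (hKconv i) (hKΩ i) hdeg (hξK i) hy).trans <|
        mul_le_mul_of_nonneg_left ((Metric.dist_le_diam_of_mem (hKsupp i).1.isBounded hy
          (hξK i)).trans (diam_le_two_mul_rMax K i)) (mul_nonneg hM hs0)
  have hsle : s ≤ Λ * (m + c * (d : ℝ) ^ r * s * (2 * rMax K)) :=
    ciSup_le fun y => abs_polyFun_le_nodalLebesgue_mul hΩ hξ p (by positivity) hnode y.2
  -- The Markov term in `hsle` is at most `α * s`; since `α < 1` it can be moved to the left.
  have hrs := mul_le_mul_of_nonneg_right hr.le hs0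
  have hle : s ≤ Λ / (1 - α) * m := by
    rw [div_mul_eq_mul_div, le_div_iff₀ (by linarith)]
    linarith
  exact (abs_polyFun_le_supNorm hΩ _ hx).trans hle

/-- Weighted duality: a bound for a linear form on the polynomials with `|L i p| ≤ w i` bounds the
weighted sum of its absolute values on the Lagrange basis. -/
theorem sum_mul_abs_apply_le {n d : ℕ} {L : Fin (polyDim n d) → PolySpace n d →ₗ[ℝ] ℝ}
    {ℓ : Fin (polyDim n d) → PolySpace n d} (hℓ : IsLagrangeBasis (fun i p => L i p) ℓ)
    {w : Fin (polyDim n d) → ℝ} (hw : ∀ i, 0 ≤ w i) (T : PolySpace n d →ₗ[ℝ] ℝ) {B : ℝ}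
    (hT : ∀ p, (∀ i, |L i p| ≤ w i) → |T p| ≤ B) : ∑ i, w i * |T (ℓ i)| ≤ B := by
  -- Extremal choice: the signs turn `T (∑ j, a j • ℓ j)` into the weighted sum itself, while `|a i|
  -- ≤ w i` keeps the combination admissible.
  let a : Fin (polyDim n d) → ℝ := fun i => w i * SignType.sign (T (ℓ i))
  have h := hT (∑ j, a j • ℓ j) fun i => by
    rw [hℓ.apply_sum, abs_mul, abs_of_nonneg (hw i)]
    refine mul_le_of_le_one_right (hw i) ?_
    cases SignType.sign (T (ℓ i)) <;> simp
  refine le_trans (le_of_eq ?_) ((le_abs_self _).trans h)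
  rw [map_sum]
  refine Finset.sum_congr rfl fun i _ => ?_
  rw [map_smul, smul_eq_mul, mul_assoc, sign_mul_self]

end Histopolation

open Histopolation in
theorem mainTheorem7 (n d : ℕ) (Ω : Set (E n)) (hΩ : IsCompact Ω)
    (c r : ℝ) (hMarkov : IsMarkov Ω c r)
    (ξ : Fin (polyDim n d) → E n) (hξ : Unisolvent (nodalDof (d := d) ξ))
    (K : Fin (polyDim n d) → Set (E n))
    (hKsupp : ∀ i, IsSupport (K i)) (hKconv : ∀ i, Convex ℝ (K i)) (hKΩ : ∀ i, K i ⊆ Ω)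
    (hξK : ∀ i, ξ i ∈ K i)
    (hnull : ∀ i j, i ≠ j → MeasureTheory.volume (K i ∩ K j) = 0)
    (α : ℝ) (hα : α ∈ Set.Ioo (0 : ℝ) 1)
    (hr : 2 * c * (d : ℝ) ^ r * nodalLebesgue (d := d) Ω ξ * rMax K < α) :
    Unisolvent (histDof (d := d) K) ∧
      histLebesgue (d := d) Ω K ≤ nodalLebesgue (d := d) Ω ξ / (1 - α) ∧
      histLebesguePt (d := d) Ω K ≤ nodalLebesgue (d := d) Ω ξ / (1 - α) := by
  have hbound := fun (p : PolySpace n d) (m : ℝ) (hm : 0 ≤ m) hp (x : E n) (hx : x ∈ Ω) =>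
    abs_polyFun_le_of_abs_average_le hΩ hMarkov hξ hKsupp hKconv hKΩ hξK hα.2 hr p
      (m := m) hm hp hx
  have huni : Unisolvent (histDof (d := d) K) := fun p hp => hξ p fun i => by
    have h := hbound p 0 le_rfl (fun i => by simp [hp i]) (ξ i) (hKΩ i (hξK i))
    rw [mul_zero] at h
    exact abs_nonpos_iff.1 h
  have hℓ := isLagrangeBasis_lagrangeBasis
    (fun i => integralForm n d (K i) (hKsupp i).1) huni
  have hunit : ∀ p : PolySpace n d,
      (∀ i, |integralForm n d (K i) (hKsupp i).1 p| ≤ volume.real (K i)) → ∀ x ∈ Ω,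
        |polyFun (p : MvPolynomial (Fin n) ℝ) x| ≤ nodalLebesgue (d := d) Ω ξ / (1 - α) :=
    fun p hp x hx => by
      simpa using hbound p 1 zero_le_one (fun i => (hp i).trans_eq (one_mul _).symm) x hx
  -- Needed because the suprema may range over an empty type, where their value is `0`.
  have hnn : 0 ≤ nodalLebesgue (d := d) Ω ξ / (1 - α) :=
    div_nonneg (nodalLebesgue_nonneg Ω ξ) (by linarith [hα.2])
  refine ⟨huni, Real.iSup_le (fun S => ?_) hnn, Real.iSup_le (fun x => ?_) hnn⟩
  · obtain ⟨S, hS, hSΩ⟩ := S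
    -- Clearing `μ(S)` leaves a duality bound for `∫_S`, which the pointwise bound controls by `Λ /
    -- (1 - α) * μ(S)`.
    rw [inv_mul_le_iff₀ hS.volume_real_pos, mul_comm]
    exact sum_mul_abs_apply_le hℓ (fun _ => measureReal_nonneg) (integralForm n d S hS.1)
      fun p hp => norm_setIntegral_le_of_norm_le_const
        (f := polyFun (p : MvPolynomial (Fin n) ℝ)) hS.1.measure_lt_top
        fun x hx => hunit p hp x (hSΩ hx)
  · exact sum_mul_abs_apply_le hℓ (fun _ => measureReal_nonneg) (evalForm n d x)
      fun p hp => hunit p hp x x.2
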